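/- **Setting.** A metrized graph $\Gamma$ is a finite connected graph (loops and multiple edges allowed) with a finite non-empty vertex set, in which every edge $e_i$ has a length $L_i>0$ and is identified with $[0,L_i]$, its end points $p_i$ and $q_i$ corresponding to $0$ and $L_i$. A point of $e_i$ is denoted by the same letter as its parameter in $[0,L_i]$. An edge is a *bridge* if deleting its interior disconnects $\Gamma$. For $x,y,z\in\Gamma$, the voltage $j_z(x,y)$ is the potential at $x$, relative to potential $0$ at $z$, when a unit current enters at $y$ and exits at $z$ and every edge has resistance equal to its length; that is, $j_z(\cdot,y)$ is the continuous piecewise affine function $f$ on $\Gamma$ with $\Delta f=\delta_y-\delta_z$ and $f(z)=0$, where $\Delta f$ has at each point the mass minus the sum of the outgoing slopes of $f$. Put $r(x,y)=j_y(x,x)$. For a real-valued signed Borel measure $\mu$ on $\Gamma$ of total mass $1$ put $j_\mu(x,y)=\int_\Gamma j_z(x,y)\,d\mu(z)$ and $$g_\mu(x,y)=\int_\Gamma j_z(x,y)\,d\mu(z)-\int_{\Gamma}\int_\Gamma\int_\Gamma j_z(x',y')\,d\mu(z)\,d\mu(x')\,d\mu(y').$$ The canonical measure $\mu_{can}$ is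 the unique such $\mu$ for which $j_\mu(x,x)$ is constant on $\Gamma$, and the tau constant is $\tau(\Gamma)=\tfrac12 j_{\mu_{can}}(x,x)$. **Theorem.** Let $e_i$ and $e_j$ be distinct edges of $\Gamma$ that are not bridges (their end points need not be distinct). If $x$ belongs to $e_i$ and $y$ belongs to $e_j$, then $$\begin{aligned} g_{\mu_{can}}(x,y) ={}& \tau(\Gamma) +x^2\, \frac{L_i - r(p_i,q_i)}{2L_i^2}+y^2\, \frac{L_j - r(p_j,q_j)}{2L_j^2} -\frac{xy}{L_i L_j} \big(j_{p_j}(p_i,q_j)-j_{p_j}(q_i,q_j)\big)\\ & -\frac{x}{2L_i} \big(L_i-2j_{p_i}(q_i,p_j)\big) -\frac{y}{2L_j} \big(L_j-2j_{p_j}(p_i,q_j)\big) -\frac{1}{2}\,r(p_i,p_j). \end{aligned}$$ If $x$ and $y$ belong to the same edge $e_i$ of $\Gamma$, then $$g_{\mu_{can}}(x,y) = \tau(\Gamma) - \frac{1}{2}|x-y|+(x-y)^2\, \frac{L_i - r(p_i,q_i)}{2L_i^2}.$$ -/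

import Mathlib

/-- A metrized graph: a finite connected multigraph with vertex set `V` and edge set `E` (loops and
multiple edges allowed).  The edge `e` is parametrized by `[0, length e]`; the parameter `0`
corresponds to the end point `src e` and `length e` to the end point `tgt e`. -/
structure MetrizedGraph (V E : Type*) where
  src : E → V
  tgt : E → V
  length : E → ℝ
  length_pos : ∀ e, 0 < length e
  nonempty : Nonempty V
  connected : ∀ u v : V, Relation.EqvGen (fun a b => ∃ e, src e = a ∧ tgt e = b) u v

noncomputable section

namespace MetrizedGraph

open MeasureTheory Set

variable {V E : Type*} (Γ : MetrizedGraph V E)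

/-- `e` is a bridge: deleting the interior of `e` disconnects the graph. -/
def IsBridge (e : E) : Prop :=
  ¬ ∀ u v : V, Relation.EqvGen (fun a b => ∃ e', e' ≠ e ∧ Γ.src e' = a ∧ Γ.tgt e' = b) u v

/-- The disjoint union of the vertices and of the closed segments `[0, length e]`. -/
def PrePoint : Type _ := V ⊕ (Σ e : E, Icc (0 : ℝ) (Γ.length e))

/-- Vertices carry the discrete topology, segments their usual topology. -/
instance : TopologicalSpace Γ.PrePoint :=
  letI : TopologicalSpace V := ⊥
  inferInstanceAs (TopologicalSpace (V ⊕ (Σ e : E, Icc (0 : ℝ) (Γ.length e))))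

/-- The gluing of the ends of the segments to the vertices. -/
inductive Glue : Γ.PrePoint → Γ.PrePoint → Prop
  | src (e : E) : Glue (Sum.inr ⟨e, ⟨0, le_rfl, (Γ.length_pos e).le⟩⟩) (Sum.inl (Γ.src e))
  | tgt (e : E) : Glue (Sum.inr ⟨e, ⟨Γ.length e, (Γ.length_pos e).le, le_rfl⟩⟩)
      (Sum.inl (Γ.tgt e))

/-- The points of the metrized graph, as a topological space (quotient topology). -/
def Point : Type _ := Quot Γ.Glue

instance : TopologicalSpace Γ.Point := inferInstanceAs (TopologicalSpace (Quot Γ.Glue))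

instance : MeasurableSpace Γ.Point := borel _

instance : BorelSpace Γ.Point := ⟨rfl⟩

/-- A vertex as a point of the graph. -/
def vertex (v : V) : Γ.Point := Quot.mk _ (Sum.inl v)

/-- The point of the edge `e` with parameter `t ∈ [0, length e]`. -/
def edgePoint (e : E) (t : Icc (0 : ℝ) (Γ.length e)) : Γ.Point := Quot.mk _ (Sum.inr ⟨e, t⟩)

/-- The end point of the edge `e` with parameter `0`. -/
def startPoint (e : E) : Γ.Point := Γ.vertex (Γ.src e)

/-- The end point of the edge `e` with parameter `length e`. -/
def endPoint (e : E) : Γ.Point := Γ.vertex (Γ.tgt e)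

variable {Γ}

/-- The function `f` read in the parameter of the edge `e`; outside `[0, length e]` it is extended
by its values at the end points. -/
def onEdge (f : Γ.Point → ℝ) (e : E) (t : ℝ) : ℝ :=
  f (Γ.edgePoint e (projIcc 0 (Γ.length e) (Γ.length_pos e).le t))

/-- `f` is continuous and piecewise affine: on every edge it is affine on all closed subintervals
that have none of finitely many break points in their interior. -/
def IsPiecewiseAffine (f : Γ.Point → ℝ) : Prop :=
  ∀ e : E, ∃ S : Finset ℝ, ∀ a b : ℝ, 0 ≤ a → a < b → b ≤ Γ.length e →
    (∀ s ∈ S, s ∉ Ioo a b) → ∃ m c : ℝ, ∀ t ∈ Icc a b, onEdge f e t = m * t + c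

/-- The slope of `f` on the edge `e` at the parameter `t`, in the direction of increasing
parameter. -/
def slopeForward (f : Γ.Point → ℝ) (e : E) (t : ℝ) : ℝ := derivWithin (onEdge f e) (Ici t) t

/-- The slope of `f` on the edge `e` at the parameter `t`, in the direction of decreasing
parameter. -/
def slopeBackward (f : Γ.Point → ℝ) (e : E) (t : ℝ) : ℝ := -derivWithin (onEdge f e) (Iic t) t

open Classical in
/-- The mass of the Laplacian `Δ f` at a vertex: minus the sum of the outgoing slopes of `f` over
all directions at the vertex.  A loop contributes two directions. -/
def laplacianVertex [Fintype E] (f : Γ.Point → ℝ) (v : V) : ℝ :=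
  -∑ e : E, ((if Γ.src e = v then slopeForward f e 0 else 0) +
    (if Γ.tgt e = v then slopeBackward f e (Γ.length e) else 0))

/-- The mass of the Laplacian `Δ f` at the interior point of the edge `e` with parameter `t`: minus
the sum of the two outgoing slopes. -/
def laplacianEdge (f : Γ.Point → ℝ) (e : E) (t : ℝ) : ℝ :=
  -(slopeForward f e t + slopeBackward f e t)

open Classical in
/-- `unitMass y p` is the mass at `p` of the Dirac measure `δ_y`. -/
def unitMass (y p : Γ.Point) : ℝ := if p = y then 1 else 0

/-- `f` is the electric potential for a unit current that enters at `y` and exits at `z`, with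
reference potential `0` at `z`, where every edge has a resistance equal to its length: `f` is
continuous and piecewise affine, `Δ f = δ_y - δ_z`, and `f z = 0`. -/
structure IsPotential [Fintype E] (z y : Γ.Point) (f : Γ.Point → ℝ) : Prop where
  piecewiseAffine : IsPiecewiseAffine f
  laplacian_vertex : ∀ v : V,
    laplacianVertex f v = unitMass y (Γ.vertex v) - unitMass z (Γ.vertex v)
  laplacian_edge : ∀ (e : E) (t : Icc (0 : ℝ) (Γ.length e)),
    0 < (t : ℝ) → (t : ℝ) < Γ.length e →
      laplacianEdge f e t = unitMass y (Γ.edgePoint e t) - unitMass z (Γ.edgePoint e t)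
  map_ground : f z = 0

/-- The voltage function `j_z(x, y)`: the potential at `x` when a unit current enters at `y` and
exits at `z`, relative to the potential at `z`. -/
def voltage [Fintype E] (z x y : Γ.Point) : ℝ := Classical.epsilon (IsPotential z y) x

/-- The resistance function `r(x, y) = j_y(x, x)`. -/
def resistance [Fintype E] (x y : Γ.Point) : ℝ := voltage y x x

/-- `j_μ(x, y) = ∫ j_z(x, y) dμ(z)` for a real-valued signed Borel measure `μ`. -/
def voltageMeasure [Fintype E] (μ : SignedMeasure Γ.Point) (x y : Γ.Point) : ℝ :=
  ∫ᵛ z, voltage z x y ∂<•μ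

/-- The Arakelov-Green function
`g_μ(x, y) = ∫ j_z(x, y) dμ(z) - ∫∫∫ j_z(x', y') dμ(z) dμ(x') dμ(y')`. -/
def arakelovGreen [Fintype E] (μ : SignedMeasure Γ.Point) (x y : Γ.Point) : ℝ :=
  (∫ᵛ z, voltage z x y ∂<•μ) -
    ∫ᵛ y', (∫ᵛ x', (∫ᵛ z, voltage z x' y' ∂<•μ) ∂<•μ) ∂<•μ

/-- `μ` has total mass `1` and `j_μ(x, x)` is constant. -/
def IsCanonicalMeasure [Fintype E] (μ : SignedMeasure Γ.Point) : Prop :=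
  μ univ = 1 ∧ ∃ c : ℝ, ∀ x, voltageMeasure μ x x = c

variable (Γ)

/-- The canonical measure `μ_can`: the signed Borel measure `μ` of total mass `1` for which
`j_μ(x, x)` is constant. -/
def canonicalMeasure [Fintype E] : SignedMeasure Γ.Point :=
  Classical.epsilon IsCanonicalMeasure

/-- The tau constant `τ(Γ)`: the constant value of `j_μ(x, x) / 2` for `μ = μ_can`. -/
def tau [Fintype E] : ℝ :=
  Classical.epsilon fun t : ℝ => ∀ x, t = voltageMeasure Γ.canonicalMeasure x x / 2

end MetrizedGraph

end

noncomputable section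

namespace MetrizedGraph

open MeasureTheory Set

variable {V E : Type*} {Γ : MetrizedGraph V E}

/-! ### Points of the graph -/

/-! Everything reduces to `arakelovGreen_canonicalMeasure`: g(x, y) = τ - r(x, y) / 2 for the
canonical measure. Polarization gives 2 j_z(x, y) = r(x, z) + r(y, z) - r(x, y)
(`voltage_eq_resistance`). Since j_z(x, x) = r(x, z), the defining property of the canonical measure
says that r(x, ·) has integral 2τ for every x. Integrating over z gives j_μ(x, y) = 2τ - r(x, y) /
2, and two further integrations give the constant τ to be subtracted.

To compute r and j, a symmetric kernel k(x, y) is built with Δ_x k(·, y) = δ_y minus the uniform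
probability measure on the vertices. It is the bilinear interpolation of a Green matrix G of the
weighted vertex Laplacian, plus the Dirichlet Green function min(s, t) - st/L of each edge.
Uniqueness of potentials then yields j_z(x, y) = k(x, y) - k(x, z) - k(z, y) + k(z, z)
(`IsGreenMatrix.voltage_eq`), and both formulas of the theorem become algebra in the entries of G.

The voltage, the canonical measure and τ are defined by choice, so existence must be proved. For the
measure this is `exists_isCanonicalMeasure`, which uses constant densities on the edges and point
masses at the vertices. Its uniqueness is not needed: the argument applies to any measure of total
mass 1 with constant j_μ(x, x). -/

theorem edgePoint_zero (e : E) :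
    Γ.edgePoint e ⟨0, le_rfl, (Γ.length_pos e).le⟩ = Γ.vertex (Γ.src e) :=
  Quot.sound (Glue.src e)

theorem edgePoint_length (e : E) :
    Γ.edgePoint e ⟨Γ.length e, (Γ.length_pos e).le, le_rfl⟩ = Γ.vertex (Γ.tgt e) :=
  Quot.sound (Glue.tgt e)

/-- Every point is a vertex or an interior point of an edge. -/
theorem point_cases {P : Γ.Point → Prop} (hv : ∀ v, P (Γ.vertex v))
    (he : ∀ (e : E) (t : Icc (0 : ℝ) (Γ.length e)), 0 < (t : ℝ) → (t : ℝ) < Γ.length e →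
      P (Γ.edgePoint e t)) (x : Γ.Point) : P x := by
  induction x using Quot.ind with
  | _ p =>
  obtain v | ⟨e, t, h0, h1⟩ := p
  · exact hv v
  · change P (Γ.edgePoint e ⟨t, h0, h1⟩)
    rcases h0.eq_or_lt with rfl | h0'
    · rw [edgePoint_zero]; exact hv _
    · rcases h1.eq_or_lt with rfl | h1'
      · rw [edgePoint_length]; exact hv _
      · exact he e _ h0' h1'

/-- The proposition that a point is the interior point `t` of the edge `e`. -/
def IsInteriorPoint (e : E) (t : ℝ) (h0 : 0 < t) (h1 : t < Γ.length e) : Γ.Point → Prop :=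
  Quot.lift (fun p => p = Sum.inr ⟨e, t, h0.le, h1.le⟩) (by
    rintro _ _ (e' | e')
    · refine propext ⟨fun h => ?_, fun h => (by cases h)⟩
      cases h; exact absurd h0 (lt_irrefl _)
    · refine propext ⟨fun h => ?_, fun h => (by cases h)⟩
      cases h; exact absurd h1 (lt_irrefl _))

/-- The gluing relation never involves an interior point, so being that point is a predicate that
descends to the quotient. -/
theorem edgePoint_eq_iff {e e' : E} {t : Icc (0 : ℝ) (Γ.length e)}
    {s : Icc (0 : ℝ) (Γ.length e')} (h0 : 0 < (t : ℝ)) (h1 : (t : ℝ) < Γ.length e) :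
    Γ.edgePoint e t = Γ.edgePoint e' s ↔ e = e' ∧ (t : ℝ) = s := by
  constructor
  · intro h
    have : IsInteriorPoint e t h0 h1 (Γ.edgePoint e' s) := by
      rw [← h]; exact rfl
    have h2 : (Sum.inr ⟨e', s⟩ : Γ.PrePoint) = Sum.inr ⟨e, t⟩ := this
    cases h2
    exact ⟨rfl, rfl⟩
  · rintro ⟨rfl, h⟩
    rw [Subtype.ext h]

theorem edgePoint_ne_vertex {e : E} {t : Icc (0 : ℝ) (Γ.length e)}
    (h0 : 0 < (t : ℝ)) (h1 : (t : ℝ) < Γ.length e) (v : V) :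
    Γ.edgePoint e t ≠ Γ.vertex v := by
  intro h
  have : IsInteriorPoint e t h0 h1 (Γ.vertex v) := by
    rw [← h]; exact rfl
  have h2 : (Sum.inl v : Γ.PrePoint) = Sum.inr ⟨e, t⟩ := this
  cases h2

theorem onEdge_apply (f : Γ.Point → ℝ) (e : E) {t : ℝ} (ht : t ∈ Icc (0 : ℝ) (Γ.length e)) :
    onEdge f e t = f (Γ.edgePoint e ⟨t, ht⟩) := by
  rw [onEdge, projIcc_of_mem _ ht]

theorem onEdge_zero (f : Γ.Point → ℝ) (e : E) : onEdge f e 0 = f (Γ.vertex (Γ.src e)) := by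
  rw [onEdge_apply f e ⟨le_rfl, (Γ.length_pos e).le⟩, edgePoint_zero]

theorem onEdge_length (f : Γ.Point → ℝ) (e : E) :
    onEdge f e (Γ.length e) = f (Γ.vertex (Γ.tgt e)) := by
  rw [onEdge_apply f e ⟨(Γ.length_pos e).le, le_rfl⟩, edgePoint_length]

theorem continuous_of_continuous_edgePoint {f : Γ.Point → ℝ}
    (hf : ∀ e, Continuous fun t => f (Γ.edgePoint e t)) : Continuous f := by
  let : TopologicalSpace V := ⊥
  have : DiscreteTopology V := ⟨rfl⟩
  refine continuous_quot_lift (f := fun p : Γ.PrePoint => f (Quot.mk _ p))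
    (fun a b h => congrArg f (Quot.sound h)) ?_ |>.congr ?_
  · refine continuous_sum_dom.2 ⟨continuous_of_discreteTopology, continuous_sigma hf⟩
  · intro x
    induction x using Quot.ind with
    | _ p => rfl

theorem continuous_edgePoint (e : E) : Continuous (Γ.edgePoint e) := by
  let : TopologicalSpace V := ⊥
  exact continuous_quot_mk.comp (continuous_inr.comp continuous_sigmaMk)

instance [Finite V] [Finite E] : CompactSpace Γ.Point := by
  let : TopologicalSpace V := ⊥
  have : CompactSpace Γ.PrePoint :=
    inferInstanceAs (CompactSpace (V ⊕ (Σ e : E, Icc (0 : ℝ) (Γ.length e))))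
  exact inferInstanceAs (CompactSpace (Quot Γ.Glue))

/-! ### Piecewise affine functions and their slopes -/

theorem IsPiecewiseAffine.add {f g : Γ.Point → ℝ} (hf : IsPiecewiseAffine f)
    (hg : IsPiecewiseAffine g) : IsPiecewiseAffine (fun x => f x + g x) := by
  classical
  intro e
  obtain ⟨S, hS⟩ := hf e
  obtain ⟨T, hT⟩ := hg e
  refine ⟨S ∪ T, fun a b ha hab hb h => ?_⟩
  obtain ⟨m, c, h1⟩ := hS a b ha hab hb fun s hs => h s (Finset.mem_union_left _ hs)
  obtain ⟨m', c', h2⟩ := hT a b ha hab hb fun s hs => h s (Finset.mem_union_right _ hs)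
  refine ⟨m + m', c + c', fun t ht => ?_⟩
  have : onEdge (fun x => f x + g x) e t = onEdge f e t + onEdge g e t := rfl
  rw [this, h1 t ht, h2 t ht]; ring

theorem IsPiecewiseAffine.sub {f g : Γ.Point → ℝ} (hf : IsPiecewiseAffine f)
    (hg : IsPiecewiseAffine g) : IsPiecewiseAffine (fun x => f x - g x) := by
  classical
  intro e
  obtain ⟨S, hS⟩ := hf e
  obtain ⟨T, hT⟩ := hg e
  refine ⟨S ∪ T, fun a b ha hab hb h => ?_⟩
  obtain ⟨m, c, h1⟩ := hS a b ha hab hb fun s hs => h s (Finset.mem_union_left _ hs)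
  obtain ⟨m', c', h2⟩ := hT a b ha hab hb fun s hs => h s (Finset.mem_union_right _ hs)
  refine ⟨m - m', c - c', fun t ht => ?_⟩
  have : onEdge (fun x => f x - g x) e t = onEdge f e t - onEdge g e t := rfl
  rw [this, h1 t ht, h2 t ht]; ring

theorem hasDerivWithinAt_Ici_of_affine {F : ℝ → ℝ} {a b m c : ℝ} (hab : a < b)
    (h : ∀ t ∈ Icc a b, F t = m * t + c) : HasDerivWithinAt F m (Ici a) a := by
  have h1 : HasDerivWithinAt (fun t => m * t + c) m (Ici a) a := by
    simpa using ((hasDerivAt_id a).const_mul m |>.add_const c).hasDerivWithinAt (s := Ici a)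
  refine h1.congr_of_eventuallyEq ?_ (h a (left_mem_Icc.2 hab.le))
  filter_upwards [Icc_mem_nhdsGE hab] with t ht using h t ht

theorem hasDerivWithinAt_Iic_of_affine {F : ℝ → ℝ} {a b m c : ℝ} (hab : a < b)
    (h : ∀ t ∈ Icc a b, F t = m * t + c) : HasDerivWithinAt F m (Iic b) b := by
  have h1 : HasDerivWithinAt (fun t => m * t + c) m (Iic b) b := by
    simpa using ((hasDerivAt_id b).const_mul m |>.add_const c).hasDerivWithinAt (s := Iic b)
  refine h1.congr_of_eventuallyEq ?_ (h b (right_mem_Icc.2 hab.le))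
  filter_upwards [Icc_mem_nhdsLE hab] with t ht using h t ht

theorem slopeForward_eq_of_affine {f : Γ.Point → ℝ} {e : E} {a b m c : ℝ} (hab : a < b)
    (h : ∀ t ∈ Icc a b, onEdge f e t = m * t + c) : slopeForward f e a = m :=
  (hasDerivWithinAt_Ici_of_affine hab h).derivWithin (uniqueDiffWithinAt_Ici a)

theorem slopeBackward_eq_of_affine {f : Γ.Point → ℝ} {e : E} {a b m c : ℝ} (hab : a < b)
    (h : ∀ t ∈ Icc a b, onEdge f e t = m * t + c) : slopeBackward f e b = -m := by
  rw [slopeBackward, (hasDerivWithinAt_Iic_of_affine hab h).derivWithin (uniqueDiffWithinAt_Iic b)]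

theorem exists_gt_forall_notMem_Ioo (S : Finset ℝ) {t l : ℝ} (h : t < l) :
    ∃ b, t < b ∧ b ≤ l ∧ ∀ s ∈ S, s ∉ Ioo t b := by
  have h1 : ∀ᶠ b in nhdsWithin t (Ioi t), ∀ s ∈ S, s ∉ Ioo t b := by
    rw [Filter.eventually_all_finset]
    intro s _
    rcases le_or_gt s t with hs | hs
    · exact Filter.Eventually.of_forall fun b hb => absurd hb.1 hs.not_gt
    · filter_upwards [Ioo_mem_nhdsGT hs] with b hb h' using absurd hb.2 h'.2.not_gt
  obtain ⟨b, hb, hb'⟩ := (h1.and (Ioc_mem_nhdsGT h)).exists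
  exact ⟨b, hb'.1, hb'.2, hb⟩

theorem exists_lt_forall_notMem_Ioo (S : Finset ℝ) {t l : ℝ} (h : l < t) :
    ∃ a, l ≤ a ∧ a < t ∧ ∀ s ∈ S, s ∉ Ioo a t := by
  have h1 : ∀ᶠ a in nhdsWithin t (Iio t), ∀ s ∈ S, s ∉ Ioo a t := by
    rw [Filter.eventually_all_finset]
    intro s _
    rcases le_or_gt t s with hs | hs
    · exact Filter.Eventually.of_forall fun b hb => absurd hb.2 hs.not_gt
    · filter_upwards [Ioo_mem_nhdsLT hs] with b hb h' using absurd hb.1 h'.1.not_gt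
  obtain ⟨b, hb, hb'⟩ := (h1.and (Ico_mem_nhdsLT h)).exists
  exact ⟨b, hb'.1, hb'.2, hb⟩

theorem IsPiecewiseAffine.exists_affine_right {f : Γ.Point → ℝ} (hf : IsPiecewiseAffine f) (e : E)
    {t : ℝ} (h0 : 0 ≤ t) (h1 : t < Γ.length e) :
    ∃ b m c, t < b ∧ b ≤ Γ.length e ∧ ∀ u ∈ Icc t b, onEdge f e u = m * u + c := by
  obtain ⟨S, hS⟩ := hf e
  obtain ⟨b, hb, hbl, hbS⟩ := exists_gt_forall_notMem_Ioo S h1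
  obtain ⟨m, c, h⟩ := hS t b h0 hb hbl hbS
  exact ⟨b, m, c, hb, hbl, h⟩

theorem IsPiecewiseAffine.exists_affine_left {f : Γ.Point → ℝ} (hf : IsPiecewiseAffine f) (e : E)
    {t : ℝ} (h0 : 0 < t) (h1 : t ≤ Γ.length e) :
    ∃ a m c, 0 ≤ a ∧ a < t ∧ ∀ u ∈ Icc a t, onEdge f e u = m * u + c := by
  obtain ⟨S, hS⟩ := hf e
  obtain ⟨a, ha, hal, haS⟩ := exists_lt_forall_notMem_Ioo S h0
  obtain ⟨m, c, h⟩ := hS a t ha hal h1 haS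
  exact ⟨a, m, c, ha, hal, h⟩

theorem IsPiecewiseAffine.differentiableWithinAt_Ici {f : Γ.Point → ℝ} (hf : IsPiecewiseAffine f)
    (e : E) {t : ℝ} (h0 : 0 ≤ t) (h1 : t < Γ.length e) :
    DifferentiableWithinAt ℝ (onEdge f e) (Ici t) t := by
  obtain ⟨b, m, c, hb, -, h⟩ := hf.exists_affine_right e h0 h1
  exact (hasDerivWithinAt_Ici_of_affine hb h).differentiableWithinAt

theorem IsPiecewiseAffine.differentiableWithinAt_Iic {f : Γ.Point → ℝ} (hf : IsPiecewiseAffine f)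
    (e : E) {t : ℝ} (h0 : 0 < t) (h1 : t ≤ Γ.length e) :
    DifferentiableWithinAt ℝ (onEdge f e) (Iic t) t := by
  obtain ⟨a, m, c, -, ha, h⟩ := hf.exists_affine_left e h0 h1
  exact (hasDerivWithinAt_Iic_of_affine ha h).differentiableWithinAt

theorem slopeForward_add {f g : Γ.Point → ℝ} (hf : IsPiecewiseAffine f) (hg : IsPiecewiseAffine g)
    (e : E) {t : ℝ} (h0 : 0 ≤ t) (h1 : t < Γ.length e) :
    slopeForward (fun x => f x + g x) e t = slopeForward f e t + slopeForward g e t :=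
  derivWithin_fun_add (hf.differentiableWithinAt_Ici e h0 h1) (hg.differentiableWithinAt_Ici e h0 h1)

theorem slopeForward_sub {f g : Γ.Point → ℝ} (hf : IsPiecewiseAffine f) (hg : IsPiecewiseAffine g)
    (e : E) {t : ℝ} (h0 : 0 ≤ t) (h1 : t < Γ.length e) :
    slopeForward (fun x => f x - g x) e t = slopeForward f e t - slopeForward g e t :=
  derivWithin_fun_sub (hf.differentiableWithinAt_Ici e h0 h1) (hg.differentiableWithinAt_Ici e h0 h1)

theorem slopeBackward_add {f g : Γ.Point → ℝ} (hf : IsPiecewiseAffine f)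
    (hg : IsPiecewiseAffine g) (e : E) {t : ℝ} (h0 : 0 < t) (h1 : t ≤ Γ.length e) :
    slopeBackward (fun x => f x + g x) e t = slopeBackward f e t + slopeBackward g e t := by
  have := derivWithin_fun_add (hf.differentiableWithinAt_Iic e h0 h1)
    (hg.differentiableWithinAt_Iic e h0 h1)
  simp only [slopeBackward]
  rw [← neg_add, ← this]
  rfl

theorem slopeBackward_sub {f g : Γ.Point → ℝ} (hf : IsPiecewiseAffine f)
    (hg : IsPiecewiseAffine g) (e : E) {t : ℝ} (h0 : 0 < t) (h1 : t ≤ Γ.length e) :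
    slopeBackward (fun x => f x - g x) e t = slopeBackward f e t - slopeBackward g e t := by
  have := derivWithin_fun_sub (hf.differentiableWithinAt_Iic e h0 h1)
    (hg.differentiableWithinAt_Iic e h0 h1)
  simp only [slopeBackward]
  rw [neg_sub_neg, ← neg_sub, ← this]
  rfl

theorem laplacianEdge_add {f g : Γ.Point → ℝ} (hf : IsPiecewiseAffine f)
    (hg : IsPiecewiseAffine g) (e : E) {t : ℝ} (h0 : 0 < t) (h1 : t < Γ.length e) :
    laplacianEdge (fun x => f x + g x) e t = laplacianEdge f e t + laplacianEdge g e t := by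
  rw [laplacianEdge, slopeForward_add hf hg e h0.le h1, slopeBackward_add hf hg e h0 h1.le,
    laplacianEdge, laplacianEdge]
  ring

theorem laplacianEdge_sub {f g : Γ.Point → ℝ} (hf : IsPiecewiseAffine f)
    (hg : IsPiecewiseAffine g) (e : E) {t : ℝ} (h0 : 0 < t) (h1 : t < Γ.length e) :
    laplacianEdge (fun x => f x - g x) e t = laplacianEdge f e t - laplacianEdge g e t := by
  rw [laplacianEdge, slopeForward_sub hf hg e h0.le h1, slopeBackward_sub hf hg e h0 h1.le,
    laplacianEdge, laplacianEdge]
  ring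

theorem laplacianVertex_add [Fintype E] {f g : Γ.Point → ℝ} (hf : IsPiecewiseAffine f)
    (hg : IsPiecewiseAffine g) (v : V) :
    laplacianVertex (fun x => f x + g x) v = laplacianVertex f v + laplacianVertex g v := by
  simp only [laplacianVertex, slopeForward_add hf hg _ le_rfl (Γ.length_pos _),
    slopeBackward_add hf hg _ (Γ.length_pos _) le_rfl]
  rw [← neg_add, ← Finset.sum_add_distrib]
  congr 1
  refine Finset.sum_congr rfl fun e _ => ?_
  split_ifs <;> ring

theorem laplacianVertex_sub [Fintype E] {f g : Γ.Point → ℝ} (hf : IsPiecewiseAffine f)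
    (hg : IsPiecewiseAffine g) (v : V) :
    laplacianVertex (fun x => f x - g x) v = laplacianVertex f v - laplacianVertex g v := by
  simp only [laplacianVertex, slopeForward_sub hf hg _ le_rfl (Γ.length_pos _),
    slopeBackward_sub hf hg _ (Γ.length_pos _) le_rfl]
  rw [← neg_add', ← sub_eq_add_neg, neg_sub, ← neg_sub, ← Finset.sum_sub_distrib]
  congr 1
  refine Finset.sum_congr rfl fun e _ => ?_
  split_ifs <;> ring

/-- A piecewise affine function whose Laplacian vanishes inside the edge `e` is affine on `e`. -/
theorem IsPiecewiseAffine.affine_of_laplacianEdge_eq_zero {f : Γ.Point → ℝ}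
    (hf : IsPiecewiseAffine f) (e : E)
    (h : ∀ t, 0 < t → t < Γ.length e → laplacianEdge f e t = 0) :
    ∃ m c, ∀ t ∈ Icc 0 (Γ.length e), onEdge f e t = m * t + c := by
  obtain ⟨b, m, c, hb, hbl, hm⟩ := hf.exists_affine_right e le_rfl (Γ.length_pos e)
  refine ⟨m, c, ?_⟩
  -- Continuous induction: the set of parameters up to which the initial affine formula persists is
  -- closed, by continuity, and open to the right, because slopes match. At the parameter 0, where
  -- there is no left slope, the initial interval is used instead.
  let A : Set ℝ := {t | ∀ u ∈ Icc 0 t, onEdge f e u = m * u + c}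
  have hcont : ContinuousOn (onEdge f e) (Icc 0 (Γ.length e)) := by
    intro t ht
    have hR : ContinuousWithinAt (onEdge f e) (Icc t (Γ.length e)) t := by
      rcases ht.2.eq_or_lt with rfl | h'
      · simp
      · exact (hf.differentiableWithinAt_Ici e ht.1 h').continuousWithinAt.mono Icc_subset_Ici_self
    have hL : ContinuousWithinAt (onEdge f e) (Icc 0 t) t := by
      rcases ht.1.eq_or_lt with rfl | h'
      · simp
      · exact (hf.differentiableWithinAt_Iic e h' ht.2).continuousWithinAt.mono Icc_subset_Iic_self
    have := hL.union hR
    rwa [Icc_union_Icc_eq_Icc ht.1 ht.2] at this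
  let Z : Set ℝ := {t | t ∈ Icc 0 (Γ.length e) ∧ onEdge f e t - (m * t + c) ∈ ({0} : Set ℝ)}
  have hZ : IsClosed Z :=
    (hcont.sub (by fun_prop)).preimage_isClosed_of_isClosed isClosed_Icc isClosed_singleton
  have hA : IsClosed (A ∩ Icc 0 (Γ.length e)) := by
    refine isClosed_of_closure_subset fun t ht => ?_
    have htI : t ∈ Icc 0 (Γ.length e) :=
      isClosed_Icc.closure_subset (closure_mono inter_subset_right ht)
    have hAZ : A ∩ Icc 0 (Γ.length e) ⊆ Z := fun u hu => ⟨hu.2, by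
      simpa [sub_eq_zero] using hu.1 u ⟨hu.2.1, le_rfl⟩⟩
    have htZ : t ∈ Z := hZ.closure_subset (closure_mono hAZ ht)
    refine ⟨fun u hu => ?_, htI⟩
    rcases hu.2.eq_or_lt with rfl | hlt
    · simpa [sub_eq_zero] using htZ.2
    · obtain ⟨t', h1, h2⟩ := mem_closure_iff.1 ht (Ioi u) isOpen_Ioi hlt
      exact h2.1 u ⟨hu.1, le_of_lt h1⟩
  have hsub : Icc 0 (Γ.length e) ⊆ A := by
    refine hA.Icc_subset_of_forall_mem_nhdsWithin
      (fun u hu => hm u ⟨hu.1, hu.2.trans hb.le⟩) fun t ht => ?_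
    rcases ht.2.1.eq_or_lt with rfl | h0
    · filter_upwards [Ioc_mem_nhdsGT hb] with u hu w hw using hm w ⟨hw.1, hw.2.trans hu.2⟩
    · obtain ⟨b', m', c', hb', -, hm'⟩ := hf.exists_affine_right e ht.2.1 ht.2.2
      -- A vanishing Laplacian at `t` equates the slopes on the two sides; continuity at `t` then
      -- equates the constant terms.
      have e1 := slopeForward_eq_of_affine hb' hm'
      have e2 := slopeBackward_eq_of_affine h0 ht.1
      have e3 := h t h0 ht.2.2
      rw [laplacianEdge, e1, e2] at e3
      obtain rfl : m' = m := by linarith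
      have e4 := hm' t ⟨le_rfl, hb'.le⟩
      rw [ht.1 t ⟨h0.le, le_rfl⟩] at e4
      obtain rfl : c = c' := by linarith
      filter_upwards [Ioc_mem_nhdsGT hb'] with u hu w hw
      rcases le_total w t with hwt | hwt
      · exact ht.1 w ⟨hw.1, hwt⟩
      · exact hm' w ⟨hwt, hw.2.trans hu.2⟩
  exact fun t ht => hsub ht t ⟨ht.1, le_rfl⟩


/-! ### The weighted Laplacian on the vertices -/

variable (Γ) in
open Classical in
/-- The Laplacian of a function on the vertices, where the edge `e` has weight `1 / length e`. -/
def vertexLaplacian [Fintype E] (h : V → ℝ) (v : V) : ℝ :=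
  ∑ e : E, ((if Γ.src e = v then (h (Γ.src e) - h (Γ.tgt e)) / Γ.length e else 0) +
    (if Γ.tgt e = v then (h (Γ.tgt e) - h (Γ.src e)) / Γ.length e else 0))

theorem vertexLaplacian_add [Fintype E] (h k : V → ℝ) :
    Γ.vertexLaplacian (h + k) = Γ.vertexLaplacian h + Γ.vertexLaplacian k := by
  funext v
  simp only [vertexLaplacian, Pi.add_apply, ← Finset.sum_add_distrib]
  refine Finset.sum_congr rfl fun e _ => ?_
  split_ifs <;> ring

theorem vertexLaplacian_smul [Fintype E] (a : ℝ) (h : V → ℝ) :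
    Γ.vertexLaplacian (a • h) = a • Γ.vertexLaplacian h := by
  funext v
  simp only [vertexLaplacian, Pi.smul_apply, smul_eq_mul, Finset.mul_sum]
  refine Finset.sum_congr rfl fun e _ => ?_
  split_ifs <;> ring

section

variable [Fintype V]

/-- Summation by parts. -/
theorem sum_mul_vertexLaplacian [Fintype E] (k h : V → ℝ) :
    ∑ v, k v * Γ.vertexLaplacian h v =
      ∑ e, (k (Γ.src e) - k (Γ.tgt e)) * (h (Γ.src e) - h (Γ.tgt e)) / Γ.length e := by
  classical
  simp only [vertexLaplacian, Finset.mul_sum]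
  rw [Finset.sum_comm]
  refine Finset.sum_congr rfl fun e _ => ?_
  simp only [mul_add, mul_ite, mul_zero, Finset.sum_add_distrib, Finset.sum_ite_eq,
    Finset.mem_univ, if_true]
  ring

theorem sum_mul_vertexLaplacian_comm [Fintype E] (k h : V → ℝ) :
    ∑ v, k v * Γ.vertexLaplacian h v = ∑ v, Γ.vertexLaplacian k v * h v := by
  simp only [mul_comm (Γ.vertexLaplacian k _), sum_mul_vertexLaplacian]
  refine Finset.sum_congr rfl fun e _ => ?_
  ring

theorem sum_vertexLaplacian [Fintype E] (h : V → ℝ) : ∑ v, Γ.vertexLaplacian h v = 0 := by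
  simpa using sum_mul_vertexLaplacian (Γ := Γ) (fun _ => 1) h

/-- The sum is the Dirichlet energy, a sum of squares divided by lengths. If it is not positive, no
edge sees a difference, and connectedness spreads the equality. -/
theorem eq_of_sum_mul_vertexLaplacian_nonpos [Fintype E] {h : V → ℝ}
    (hh : ∑ v, h v * Γ.vertexLaplacian h v ≤ 0) (u v : V) : h u = h v := by
  rw [sum_mul_vertexLaplacian] at hh
  have hnn : ∀ e ∈ Finset.univ,
      0 ≤ (h (Γ.src e) - h (Γ.tgt e)) * (h (Γ.src e) - h (Γ.tgt e)) / Γ.length e :=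
    fun e _ => div_nonneg (mul_self_nonneg _) (Γ.length_pos e).le
  have h0 := (Finset.sum_eq_zero_iff_of_nonneg hnn).1 (le_antisymm hh (Finset.sum_nonneg hnn))
  induction Γ.connected u v with
  | rel a b hab =>
    obtain ⟨e, rfl, rfl⟩ := hab
    have := h0 e (Finset.mem_univ e)
    rcases div_eq_zero_iff.1 this with h1 | h1
    · exact sub_eq_zero.1 (mul_self_eq_zero.1 h1)
    · exact absurd h1 (Γ.length_pos e).ne'
  | refl a => rfl
  | symm a b _ ih => exact ih.symm
  | trans a b c _ _ ih1 ih2 => exact ih1.trans ih2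

/-- `G` is a symmetric Green matrix of the weighted Laplacian on the vertices. -/
structure IsGreenMatrix [Fintype E] (G : V → V → ℝ) : Prop where
  symm : ∀ u v, G u v = G v u
  sum_eq : ∀ u, ∑ v, G u v = 1 / Fintype.card V
  vertexLaplacian_self : ∀ v, Γ.vertexLaplacian (fun u => G u v) v = 1 - 1 / Fintype.card V
  vertexLaplacian_of_ne : ∀ u v, u ≠ v → Γ.vertexLaplacian (fun w => G w v) u = -(1 / Fintype.card V)

-- The Laplacian is singular exactly on constants. Adding the rank-one map that sends `h` to its
-- total makes it injective, hence bijective, and `G` is its inverse matrix; symmetry of `G` comes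
-- from self-adjointness.
variable (Γ) in
theorem exists_isGreenMatrix [Fintype E] : ∃ G : V → V → ℝ, IsGreenMatrix (Γ := Γ) G := by
  classical
  have : Nonempty V := Γ.nonempty
  have hn : (Fintype.card V : ℝ) ≠ 0 := Nat.cast_ne_zero.2 Fintype.card_ne_zero
  let T : (V → ℝ) →ₗ[ℝ] (V → ℝ) :=
    { toFun := fun h v => Γ.vertexLaplacian h v + ∑ w, h w
      map_add' := fun h k => by
        funext v
        simp only [vertexLaplacian_add, Pi.add_apply, Finset.sum_add_distrib]; ring
      map_smul' := fun a h => by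
        funext v
        simp only [vertexLaplacian_smul, Pi.smul_apply, smul_eq_mul, ← Finset.mul_sum,
          RingHom.id_apply]
        ring }
  have hTdef : ∀ h v, T h v = Γ.vertexLaplacian h v + ∑ w, h w := fun _ _ => rfl
  have hpair : ∀ k h : V → ℝ, ∑ v, k v * T h v =
      ∑ v, k v * Γ.vertexLaplacian h v + (∑ v, k v) * ∑ v, h v := fun k h => by
    simp only [hTdef, mul_add, Finset.sum_add_distrib, Finset.sum_mul]
  -- For `h` in the kernel, energy plus squared total is 0; so `h` is constant, and its total, card
  -- V times that constant, vanishes.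
  have hinj : Function.Injective T := by
    refine (injective_iff_map_eq_zero T).2 fun h hh => ?_
    have h1 := hpair h h
    simp only [hh, Pi.zero_apply, mul_zero, Finset.sum_const_zero] at h1
    have h2 := eq_of_sum_mul_vertexLaplacian_nonpos (Γ := Γ) (h := h)
      (by nlinarith [mul_self_nonneg (∑ v, h v)])
    funext v
    have h3 : ∑ w, h w = Fintype.card V * h v := by
      rw [Finset.sum_congr rfl fun w _ => h2 w v]; simp
    have h4 : T h v = 0 := by rw [hh]; rfl
    have h5 : Γ.vertexLaplacian h v = 0 := by
      simp [vertexLaplacian, h2 _ v]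
    rw [hTdef, h5, h3, zero_add] at h4
    exact (mul_eq_zero.1 h4).resolve_left hn
  have hsurj := LinearMap.injective_iff_surjective.1 hinj
  choose g hg using fun w : V => hsurj (Pi.single w 1)
  have hsum : ∀ w, ∑ v, g w v = 1 / Fintype.card V := fun w => by
    have h1 := hpair (fun _ => 1) (g w)
    rw [hg] at h1
    simp only [one_mul, sum_vertexLaplacian, Finset.sum_pi_single', Finset.mem_univ, if_true] at h1
    simp only [Finset.sum_const, Finset.card_univ, nsmul_eq_mul, mul_one, zero_add] at h1
    rw [h1]
    field_simp
  have hsymm : ∀ u v, g v u = g u v := fun u v => by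
    have h1 := hpair (g v) (g u)
    have h2 := hpair (g u) (g v)
    rw [sum_mul_vertexLaplacian_comm] at h2
    rw [hg] at h1 h2
    simp only [Pi.single_apply, mul_ite, mul_one, mul_zero, Finset.sum_ite_eq',
      Finset.mem_univ, if_true] at h1 h2
    rw [h1, h2, mul_comm (∑ v, g u v)]
    congr 1
    exact Finset.sum_congr rfl fun _ _ => mul_comm _ _
  have hlap : ∀ v u, Γ.vertexLaplacian (g v) u = (Pi.single v 1 : V → ℝ) u - 1 / Fintype.card V :=
    fun v u => by rw [← hg, hTdef, hsum]; ring
  refine ⟨fun u v => g v u, hsymm, fun u => ?_, fun v => ?_, fun u v huv => ?_⟩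
  · simp only [hsymm u]; exact hsum u
  · simp [hlap]
  · simp [hlap, huv]

end

/-! ### Affine interpolation -/


/-- The function on the graph that is affine on the edges and equal to `h` at the vertices. -/
def interpolate (h : V → ℝ) : Γ.Point → ℝ :=
  Quot.lift (fun p => match p with
    | Sum.inl v => h v
    | Sum.inr ⟨e, t⟩ => h (Γ.src e) + (t : ℝ) / Γ.length e * (h (Γ.tgt e) - h (Γ.src e))) (by
    rintro _ _ (e | e)
    · simp
    · simp [div_self (Γ.length_pos e).ne'])

@[simp]
theorem interpolate_vertex (h : V → ℝ) (v : V) : interpolate h (Γ.vertex v) = h v := rfl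

theorem interpolate_edgePoint (h : V → ℝ) (e : E) (t : Icc (0 : ℝ) (Γ.length e)) :
    interpolate h (Γ.edgePoint e t) =
      h (Γ.src e) + (t : ℝ) / Γ.length e * (h (Γ.tgt e) - h (Γ.src e)) := rfl

theorem interpolate_const (c : ℝ) (x : Γ.Point) : interpolate (fun _ => c) x = c := by
  induction x using point_cases with
  | hv v => rfl
  | he e t h0 h1 => simp [interpolate_edgePoint]

theorem interpolate_add (h k : V → ℝ) (x : Γ.Point) :
    interpolate (fun v => h v + k v) x = interpolate h x + interpolate k x := by
  induction x using point_cases with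
  | hv v => rfl
  | he e t h0 h1 => simp only [interpolate_edgePoint]; ring

theorem interpolate_sub (h k : V → ℝ) (x : Γ.Point) :
    interpolate (fun v => h v - k v) x = interpolate h x - interpolate k x := by
  induction x using point_cases with
  | hv v => rfl
  | he e t h0 h1 => simp only [interpolate_edgePoint]; ring

theorem interpolate_const_mul (c : ℝ) (h : V → ℝ) (x : Γ.Point) :
    interpolate (fun v => c * h v) x = c * interpolate h x := by
  induction x using point_cases with
  | hv v => rfl
  | he e t h0 h1 => simp only [interpolate_edgePoint]; ring

theorem interpolate_sum {ι : Type*} (s : Finset ι) (h : ι → V → ℝ) (x : Γ.Point) :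
    interpolate (fun v => ∑ i ∈ s, h i v) x = ∑ i ∈ s, interpolate (h i) x := by
  induction x using point_cases with
  | hv v => rfl
  | he e t h0 h1 =>
    simp only [interpolate_edgePoint, Finset.sum_add_distrib, ← Finset.mul_sum,
      Finset.sum_sub_distrib]

/-- Interpolation in two variables does not depend on the order. -/
theorem interpolate_comm (K : V → V → ℝ) (x y : Γ.Point) :
    interpolate (fun u => interpolate (fun v => K u v) y) x =
      interpolate (fun v => interpolate (fun u => K u v) x) y := by
  induction x using point_cases with
  | hv v => rfl
  | he e t h0 h1 =>
    simp only [interpolate_edgePoint, interpolate_add, interpolate_sub, interpolate_const_mul]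

theorem onEdge_interpolate (h : V → ℝ) (e : E) {t : ℝ} (ht : t ∈ Icc (0 : ℝ) (Γ.length e)) :
    onEdge (interpolate h : Γ.Point → ℝ) e t =
      (h (Γ.tgt e) - h (Γ.src e)) / Γ.length e * t + h (Γ.src e) := by
  rw [onEdge_apply _ e ht, interpolate_edgePoint]; ring

theorem isPiecewiseAffine_interpolate (h : V → ℝ) :
    IsPiecewiseAffine (interpolate h : Γ.Point → ℝ) := fun e =>
  ⟨∅, fun _ _ ha _ hb _ => ⟨_, _, fun _ ht =>
    onEdge_interpolate h e ⟨ha.trans ht.1, ht.2.trans hb⟩⟩⟩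

theorem laplacianVertex_interpolate [Fintype E] (h : V → ℝ) (v : V) :
    laplacianVertex (interpolate h : Γ.Point → ℝ) v = Γ.vertexLaplacian h v := by
  rw [laplacianVertex, vertexLaplacian, ← Finset.sum_neg_distrib]
  refine Finset.sum_congr rfl fun e _ => ?_
  rw [slopeForward_eq_of_affine (Γ.length_pos e) fun t ht => onEdge_interpolate h e ht,
    slopeBackward_eq_of_affine (Γ.length_pos e) fun t ht => onEdge_interpolate h e ht]
  split_ifs <;> ring

theorem laplacianEdge_interpolate (h : V → ℝ) (e : E) {t : ℝ} (h0 : 0 < t)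
    (h1 : t < Γ.length e) : laplacianEdge (interpolate h : Γ.Point → ℝ) e t = 0 := by
  rw [laplacianEdge,
    slopeForward_eq_of_affine h1 fun t ht => onEdge_interpolate h e ⟨h0.le.trans ht.1, ht.2⟩,
    slopeBackward_eq_of_affine h0 fun t ht => onEdge_interpolate h e ⟨ht.1, ht.2.trans h1.le⟩]
  ring

theorem continuous_interpolate (h : V → ℝ) : Continuous (interpolate h : Γ.Point → ℝ) :=
  continuous_of_continuous_edgePoint fun e => by
    simp only [interpolate_edgePoint]; fun_prop

/-! ### The Green function of a single edge -/

open Classical in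
/-- The Green function of the segments with zero boundary values at the vertices. -/
def edgeGreen : Γ.Point → Γ.Point → ℝ :=
  Quot.lift₂ (fun p q => match p, q with
    | Sum.inr ⟨e, s⟩, Sum.inr ⟨e', t⟩ =>
      if e = e' then min (s : ℝ) t - (s : ℝ) * t / Γ.length e else 0
    | _, _ => 0)
    (by
      rintro (v | ⟨e, s, hs⟩) _ _ (e' | e')
      · rfl
      · rfl
      · by_cases h : e = e'
        · subst h; simp [hs.1]
        · simp [h]
      · by_cases h : e = e'
        · subst h; simp [hs.2, (Γ.length_pos e).ne']
        · simp [h])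
    (by
      rintro _ _ (v | ⟨e, s, hs⟩) (e' | e')
      · rfl
      · rfl
      · by_cases h : e' = e
        · subst h; simp [hs.1]
        · simp [h]
      · by_cases h : e' = e
        · subst h; simp [hs.2, mul_div_cancel_left₀ _ (Γ.length_pos e').ne']
        · simp [h])

@[simp]
theorem edgeGreen_vertex_left (v : V) (y : Γ.Point) : edgeGreen (Γ.vertex v) y = 0 := by
  induction y using Quot.ind with
  | _ p => rfl

theorem edgeGreen_edgePoint_self (e : E) (s t : Icc (0 : ℝ) (Γ.length e)) :
    edgeGreen (Γ.edgePoint e s) (Γ.edgePoint e t) =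
      min (s : ℝ) t - (s : ℝ) * t / Γ.length e :=
  if_pos rfl

theorem edgeGreen_edgePoint_of_ne {e e' : E} (h : e ≠ e') (s : Icc (0 : ℝ) (Γ.length e))
    (t : Icc (0 : ℝ) (Γ.length e')) :
    edgeGreen (Γ.edgePoint e s) (Γ.edgePoint e' t) = 0 :=
  if_neg h

theorem edgeGreen_comm (x y : Γ.Point) : edgeGreen x y = edgeGreen y x := by
  induction x using Quot.ind with
  | _ p =>
  induction y using Quot.ind with
  | _ q =>
  obtain v | ⟨e, s⟩ := p <;> obtain w | ⟨e', t⟩ := q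
  · rfl
  · rfl
  · rfl
  · change edgeGreen (Γ.edgePoint e s) (Γ.edgePoint e' t) =
      edgeGreen (Γ.edgePoint e' t) (Γ.edgePoint e s)
    by_cases h : e = e'
    · subst h
      rw [edgeGreen_edgePoint_self, edgeGreen_edgePoint_self, min_comm, mul_comm (s : ℝ)]
    · rw [edgeGreen_edgePoint_of_ne h, edgeGreen_edgePoint_of_ne (Ne.symm h)]

@[simp]
theorem edgeGreen_vertex_right (x : Γ.Point) (v : V) : edgeGreen x (Γ.vertex v) = 0 := by
  rw [edgeGreen_comm, edgeGreen_vertex_left]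

theorem onEdge_edgeGreen_of_le (e : E) (s : Icc (0 : ℝ) (Γ.length e)) {t : ℝ}
    (h0 : 0 ≤ t) (hts : t ≤ s) :
    onEdge (fun x => edgeGreen x (Γ.edgePoint e s)) e t = (1 - s / Γ.length e) * t + 0 := by
  rw [onEdge_apply _ e ⟨h0, hts.trans s.2.2⟩, edgeGreen_edgePoint_self, min_eq_left hts]
  ring

theorem onEdge_edgeGreen_of_ge (e : E) (s : Icc (0 : ℝ) (Γ.length e)) {t : ℝ}
    (hst : s ≤ t) (h1 : t ≤ Γ.length e) :
    onEdge (fun x => edgeGreen x (Γ.edgePoint e s)) e t = (-(s / Γ.length e)) * t + s := by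
  rw [onEdge_apply _ e ⟨s.2.1.trans hst, h1⟩, edgeGreen_edgePoint_self, min_eq_right hst]
  ring

theorem onEdge_edgeGreen_of_ne {e e' : E} (h : e ≠ e') (s : Icc (0 : ℝ) (Γ.length e')) (t : ℝ) :
    onEdge (fun x => edgeGreen x (Γ.edgePoint e' s)) e t = 0 * t + 0 := by
  rw [onEdge, edgeGreen_edgePoint_of_ne h]; ring

theorem onEdge_edgeGreen_vertex (e : E) (v : V) (t : ℝ) :
    onEdge (fun x => edgeGreen x (Γ.vertex v)) e t = 0 * t + 0 := by
  rw [onEdge, edgeGreen_vertex_right]; ring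

theorem isPiecewiseAffine_edgeGreen (y : Γ.Point) :
    IsPiecewiseAffine (fun x => edgeGreen x y) := by
  intro e
  induction y using point_cases with
  | hv v => exact ⟨∅, fun _ _ _ _ _ _ => ⟨0, 0, fun t _ => onEdge_edgeGreen_vertex e v t⟩⟩
  | he e' s h0 h1 =>
    by_cases h : e = e'
    · subst h
      refine ⟨{(s : ℝ)}, fun a b ha hab hb hs => ?_⟩
      have hs' := hs s (Finset.mem_singleton_self _)
      rcases le_or_gt b s with hbs | hbs
      · exact ⟨_, _, fun t ht => onEdge_edgeGreen_of_le e s (ha.trans ht.1) (ht.2.trans hbs)⟩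
      · have : (s : ℝ) ≤ a := le_of_not_gt fun h => hs' ⟨h, hbs⟩
        exact ⟨_, _, fun t ht => onEdge_edgeGreen_of_ge e s (this.trans ht.1) (ht.2.trans hb)⟩
    · exact ⟨∅, fun _ _ _ _ _ _ => ⟨0, 0, fun t _ => onEdge_edgeGreen_of_ne h s t⟩⟩

theorem continuous_edgeGreen (y : Γ.Point) : Continuous (fun x => edgeGreen x y) := by
  refine continuous_of_continuous_edgePoint fun e => ?_
  induction y using point_cases with
  | hv v => simp only [edgeGreen_vertex_right]; fun_prop
  | he e' s h0 h1 =>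
    by_cases h : e = e'
    · subst h
      simp only [edgeGreen_edgePoint_self]; fun_prop
    · simp only [edgeGreen_edgePoint_of_ne h]; fun_prop

theorem laplacianEdge_edgeGreen (y : Γ.Point) (e : E) (t : Icc (0 : ℝ) (Γ.length e))
    (h0 : 0 < (t : ℝ)) (h1 : (t : ℝ) < Γ.length e) :
    laplacianEdge (fun x => edgeGreen x y) e t = unitMass y (Γ.edgePoint e t) := by
  induction y using point_cases with
  | hv v =>
    rw [laplacianEdge, slopeForward_eq_of_affine h1 fun t _ => onEdge_edgeGreen_vertex e v t,
      slopeBackward_eq_of_affine h0 fun t _ => onEdge_edgeGreen_vertex e v t, unitMass,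
      if_neg (edgePoint_ne_vertex h0 h1 v)]
    ring
  | he e' s hs0 hs1 =>
    rw [unitMass]
    by_cases h : e = e'
    · subst h
      rw [laplacianEdge]
      rcases lt_trichotomy (t : ℝ) s with hts | hts | hts
      · rw [slopeForward_eq_of_affine hts fun u hu =>
            onEdge_edgeGreen_of_le e s (h0.le.trans hu.1) hu.2,
          slopeBackward_eq_of_affine h0 fun u hu =>
            onEdge_edgeGreen_of_le e s hu.1 (hu.2.trans hts.le),
          if_neg fun h => hts.ne ((edgePoint_eq_iff h0 h1).1 h).2]
        ring
      · rw [slopeForward_eq_of_affine h1 fun u hu =>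
            onEdge_edgeGreen_of_ge e s (hts.symm.le.trans hu.1) hu.2,
          slopeBackward_eq_of_affine h0 fun u hu =>
            onEdge_edgeGreen_of_le e s hu.1 (hu.2.trans hts.le),
          if_pos ((edgePoint_eq_iff h0 h1).2 ⟨rfl, hts⟩)]
        ring
      · rw [slopeForward_eq_of_affine h1 fun u hu =>
            onEdge_edgeGreen_of_ge e s (hts.le.trans hu.1) hu.2,
          slopeBackward_eq_of_affine hts fun u hu =>
            onEdge_edgeGreen_of_ge e s hu.1 (hu.2.trans h1.le),
          if_neg fun h => hts.ne' ((edgePoint_eq_iff h0 h1).1 h).2]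
        ring
    · rw [laplacianEdge, slopeForward_eq_of_affine h1 fun t _ => onEdge_edgeGreen_of_ne h s t,
        slopeBackward_eq_of_affine h0 fun t _ => onEdge_edgeGreen_of_ne h s t,
        if_neg fun h' => h ((edgePoint_eq_iff h0 h1).1 h').1]
      ring

theorem vertex_injective : Function.Injective Γ.vertex := by
  classical
  intro v w h
  by_contra hvw
  have := congrArg (interpolate fun u => if u = v then (1 : ℝ) else 0) h
  simp [Ne.symm hvw] at this

-- For y at parameter s of an edge, the outgoing slopes at the two ends are 1 - s/L and s/L. Hence
-- the compensating negative masses at the ends are the barycentric weights of y, that is, the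
-- interpolated indicator of `v` evaluated at y. For y a vertex both terms cancel.
open Classical in
theorem laplacianVertex_edgeGreen [Fintype E] (y : Γ.Point) (v : V) :
    laplacianVertex (fun x => edgeGreen x y) v =
      unitMass y (Γ.vertex v) - interpolate (fun u => if u = v then 1 else 0) y := by
  induction y using point_cases with
  | hv w =>
    rw [laplacianVertex]
    simp only [unitMass, vertex_injective.eq_iff, interpolate_vertex]
    rw [Finset.sum_eq_zero fun e _ => ?_]
    · simp [eq_comm]
    · rw [slopeForward_eq_of_affine (Γ.length_pos e) fun t _ => onEdge_edgeGreen_vertex e w t,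
        slopeBackward_eq_of_affine (Γ.length_pos e) fun t _ => onEdge_edgeGreen_vertex e w t]
      simp
  | he e' s hs0 hs1 =>
    rw [laplacianVertex, unitMass, if_neg (edgePoint_ne_vertex hs0 hs1 v).symm,
      interpolate_edgePoint, Finset.sum_eq_single e']
    · rw [slopeForward_eq_of_affine hs0 fun u hu => onEdge_edgeGreen_of_le e' s hu.1 hu.2,
        slopeBackward_eq_of_affine hs1 fun u hu => onEdge_edgeGreen_of_ge e' s hu.1 hu.2]
      split_ifs <;> ring
    · intro e _ h
      rw [slopeForward_eq_of_affine (Γ.length_pos e) fun t _ => onEdge_edgeGreen_of_ne h s t,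
        slopeBackward_eq_of_affine (Γ.length_pos e) fun t _ => onEdge_edgeGreen_of_ne h s t]
      simp
    · simp

/-! ### The potential kernel and the voltage function -/

/-- The potential kernel built from a Green matrix on the vertices. -/
def potentialKernel (G : V → V → ℝ) (x y : Γ.Point) : ℝ :=
  interpolate (fun u => interpolate (fun v => G u v) y) x + edgeGreen x y

theorem isPiecewiseAffine_potentialKernel (G : V → V → ℝ) (y : Γ.Point) :
    IsPiecewiseAffine (fun x => potentialKernel G x y) :=
  (isPiecewiseAffine_interpolate _).add (isPiecewiseAffine_edgeGreen y)

theorem continuous_potentialKernel (G : V → V → ℝ) (y : Γ.Point) :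
    Continuous (fun x => potentialKernel G x y) :=
  (continuous_interpolate _).add (continuous_edgeGreen y)

theorem laplacianEdge_potentialKernel (G : V → V → ℝ) (y : Γ.Point) (e : E)
    (t : Icc (0 : ℝ) (Γ.length e)) (h0 : 0 < (t : ℝ)) (h1 : (t : ℝ) < Γ.length e) :
    laplacianEdge (fun x => potentialKernel G x y) e t = unitMass y (Γ.edgePoint e t) := by
  have := laplacianEdge_add (isPiecewiseAffine_interpolate (fun u => interpolate (fun v => G u v) y))
    (isPiecewiseAffine_edgeGreen y) e h0 h1
  rw [laplacianEdge_interpolate _ e h0 h1, laplacianEdge_edgeGreen y e t h0 h1, zero_add] at this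
  exact this

theorem vertexLaplacian_interpolate [Fintype E] {K : V → V → ℝ} (y : Γ.Point) (v : V) :
    Γ.vertexLaplacian (fun u => interpolate (fun w => K u w) y) v =
      interpolate (fun w => Γ.vertexLaplacian (fun u => K u w) v) y := by
  induction y using point_cases with
  | hv w => rfl
  | he e t h0 h1 =>
    simp only [interpolate_edgePoint, vertexLaplacian, ← Finset.sum_sub_distrib, Finset.mul_sum,
      ← Finset.sum_add_distrib]
    refine Finset.sum_congr rfl fun e _ => ?_
    split_ifs <;> ring

theorem isPiecewiseAffine_const (c : ℝ) : IsPiecewiseAffine (fun _ : Γ.Point => c) := fun _ =>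
  ⟨∅, fun _ _ _ _ _ _ => ⟨0, c, fun t _ => by simp [onEdge]⟩⟩

section

variable [Fintype V] [Fintype E]

theorem IsGreenMatrix.potentialKernel_comm {G : V → V → ℝ} (hG : IsGreenMatrix (Γ := Γ) G)
    (x y : Γ.Point) : potentialKernel G x y = potentialKernel G y x := by
  rw [potentialKernel, potentialKernel, interpolate_comm, edgeGreen_comm]
  simp only [hG.symm]

/-- The interpolated part contributes the barycentric weight of `y` at `v` minus 1/card V, and the
edge part removes exactly that weight. -/
theorem IsGreenMatrix.laplacianVertex_potentialKernel {G : V → V → ℝ}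
    (hG : IsGreenMatrix (Γ := Γ) G) (y : Γ.Point) (v : V) :
    laplacianVertex (fun x => potentialKernel G x y) v =
      unitMass y (Γ.vertex v) - 1 / Fintype.card V := by
  classical
  have := laplacianVertex_add
    (isPiecewiseAffine_interpolate (fun u => interpolate (fun v => G u v) y))
    (isPiecewiseAffine_edgeGreen y) v
  rw [laplacianVertex_interpolate, laplacianVertex_edgeGreen y, vertexLaplacian_interpolate] at this
  have h1 : (fun w => Γ.vertexLaplacian (fun u => G u w) v) =
      fun w => (if w = v then (1 : ℝ) else 0) - 1 / Fintype.card V := by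
    funext w
    by_cases h : w = v
    · subst h; simp [hG.vertexLaplacian_self]
    · simp [hG.vertexLaplacian_of_ne v w (Ne.symm h), h]
  rw [h1, interpolate_sub, interpolate_const] at this
  refine Eq.trans this ?_
  -- The two indicators differ only in their decidability instances.
  have h2 : (fun u : V => @ite ℝ (u = v) (Classical.propDecidable _) 1 0) =
    fun u => if u = v then (1 : ℝ) else 0 := by funext u; congr
  rw [h2]
  ring

/-- The uniform background masses at the vertices cancel in the difference of two kernels; the
subtracted constant grounds the function at `z`. -/
theorem IsGreenMatrix.isPotential {G : V → V → ℝ} (hG : IsGreenMatrix (Γ := Γ) G)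
    (z y : Γ.Point) :
    IsPotential z y fun x => potentialKernel G x y - potentialKernel G x z -
      (potentialKernel G z y - potentialKernel G z z) := by
  have hy := isPiecewiseAffine_potentialKernel (Γ := Γ) G y
  have hz := isPiecewiseAffine_potentialKernel (Γ := Γ) G z
  have hc := isPiecewiseAffine_const (Γ := Γ) (potentialKernel G z y - potentialKernel G z z)
  have hc' : ∀ (c : ℝ), (fun _ : Γ.Point => c) = interpolate fun _ => c :=
    fun c => funext fun x => (interpolate_const c x).symm
  refine ⟨(hy.sub hz).sub hc, fun v => ?_, fun e t h0 h1 => ?_, by ring⟩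
  · rw [laplacianVertex_sub (hy.sub hz) hc, laplacianVertex_sub hy hz,
      hG.laplacianVertex_potentialKernel, hG.laplacianVertex_potentialKernel, hc',
      laplacianVertex_interpolate]
    simp [vertexLaplacian]
  · rw [laplacianEdge_sub (hy.sub hz) hc e h0 h1, laplacianEdge_sub hy hz e h0 h1,
      laplacianEdge_potentialKernel _ _ _ _ h0 h1, laplacianEdge_potentialKernel _ _ _ _ h0 h1,
      hc', laplacianEdge_interpolate _ e h0 h1]
    ring

/-- The difference has zero Laplacian, so it is affine on every edge and determined by vertex values
of zero energy. It is therefore constant, and it vanishes at `z`. -/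
theorem IsPotential.unique {z y : Γ.Point} {f g : Γ.Point → ℝ} (hf : IsPotential z y f)
    (hg : IsPotential z y g) : f = g := by
  let d : Γ.Point → ℝ := fun x => f x - g x
  have hd : IsPiecewiseAffine d := hf.piecewiseAffine.sub hg.piecewiseAffine
  have hde : ∀ e t, 0 < t → t < Γ.length e → laplacianEdge d e t = 0 := fun e t h0 h1 => by
    rw [laplacianEdge_sub hf.piecewiseAffine hg.piecewiseAffine e h0 h1,
      hf.laplacian_edge e ⟨t, h0.le, h1.le⟩ h0 h1, hg.laplacian_edge e ⟨t, h0.le, h1.le⟩ h0 h1,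
      sub_self]
  have hdi : d = interpolate fun v => d (Γ.vertex v) := by
    funext x
    induction x using point_cases with
    | hv v => rfl
    | he e t h0 h1 =>
      obtain ⟨m, c, h⟩ := hd.affine_of_laplacianEdge_eq_zero e (hde e)
      have ha := h 0 ⟨le_rfl, (Γ.length_pos e).le⟩
      have hb := h (Γ.length e) ⟨(Γ.length_pos e).le, le_rfl⟩
      have ht := h t t.2
      rw [onEdge_zero] at ha
      rw [onEdge_length] at hb
      rw [onEdge_apply _ _ t.2] at ht
      rw [interpolate_edgePoint, ha, hb]
      refine ht.trans ?_
      have := (Γ.length_pos e).ne'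
      field_simp
      ring
  have hlap : ∀ v, Γ.vertexLaplacian (fun v => d (Γ.vertex v)) v = 0 := fun v => by
    rw [← laplacianVertex_interpolate, ← hdi,
      laplacianVertex_sub hf.piecewiseAffine hg.piecewiseAffine, hf.laplacian_vertex,
      hg.laplacian_vertex, sub_self]
  have hconst := eq_of_sum_mul_vertexLaplacian_nonpos (Γ := Γ) (h := fun v => d (Γ.vertex v))
    (by simp [hlap])
  obtain ⟨v₀⟩ := Γ.nonempty
  have hd0 : ∀ x, d x = d (Γ.vertex v₀) := fun x => by
    rw [hdi, interpolate_vertex, funext fun v => hconst v v₀, interpolate_const]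
  have hz : d z = 0 := by simp only [d, hf.map_ground, hg.map_ground, sub_self]
  funext x
  have : d x = 0 := by rw [hd0, ← hd0 z, hz]
  exact sub_eq_zero.1 this

theorem IsGreenMatrix.voltage_eq {G : V → V → ℝ} (hG : IsGreenMatrix (Γ := Γ) G)
    (z x y : Γ.Point) :
    voltage z x y = potentialKernel G x y - potentialKernel G x z -
      (potentialKernel G z y - potentialKernel G z z) := by
  have h := hG.isPotential z y
  exact congrFun ((Classical.epsilon_spec (p := IsPotential z y) ⟨_, h⟩).unique h) x


end

/-! ### Integration against signed measures -/

instance isFiniteMeasure_variation {X : Type*} [MeasurableSpace X] (μ : SignedMeasure X) :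
    IsFiniteMeasure μ.variation := by
  rw [← SignedMeasure.totalVariation_eq_variation]; infer_instance

theorem integrable_of_continuous [Finite V] [Finite E] (μ : SignedMeasure Γ.Point)
    {f : Γ.Point → ℝ} (hf : Continuous f) : μ.Integrable f := by
  obtain ⟨C, hC⟩ := isCompact_univ.exists_bound_of_continuousOn hf.continuousOn
  exact Integrable.of_bound hf.measurable.aestronglyMeasurable C
    (Filter.Eventually.of_forall fun x => hC x (mem_univ x))

theorem integral_const_signed {X : Type*} [MeasurableSpace X] (μ : SignedMeasure X) (c : ℝ) :
    ∫ᵛ _, c ∂<•μ = μ univ * c := by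
  rw [VectorMeasure.integral_const]; simp

theorem integral_const_mul_signed {X : Type*} [MeasurableSpace X] (μ : SignedMeasure X) (c : ℝ)
    (f : X → ℝ) : ∫ᵛ x, c * f x ∂<•μ = c * ∫ᵛ x, f x ∂<•μ :=
  VectorMeasure.integral_fun_smul μ _ c f

variable (Γ) in
/-- Lebesgue measure on the edge `e`, as a measure on the graph. -/
def edgeMeasure (e : E) : Measure Γ.Point :=
  (volume.restrict (Icc 0 (Γ.length e))).map
    fun t => Γ.edgePoint e (projIcc 0 (Γ.length e) (Γ.length_pos e).le t)

theorem measurable_edgePoint_projIcc (e : E) :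
    Measurable fun t => Γ.edgePoint e (projIcc 0 (Γ.length e) (Γ.length_pos e).le t) :=
  ((continuous_edgePoint e).comp continuous_projIcc).measurable

instance (e : E) : IsFiniteMeasure (Γ.edgeMeasure e) := by
  unfold edgeMeasure; infer_instance

theorem integral_edgeMeasure (e : E) {f : Γ.Point → ℝ} (hf : Continuous f) :
    ∫ x, f x ∂(Γ.edgeMeasure e) = ∫ t in (0 : ℝ)..Γ.length e, onEdge f e t := by
  rw [edgeMeasure, integral_map (measurable_edgePoint_projIcc e).aemeasurable
    hf.measurable.aestronglyMeasurable, intervalIntegral.integral_of_le (Γ.length_pos e).le,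
    integral_Icc_eq_integral_Ioc]
  rfl

theorem integral_onEdge_interpolate (h : V → ℝ) (e : E) :
    ∫ t in (0 : ℝ)..Γ.length e, onEdge (interpolate h : Γ.Point → ℝ) e t =
      Γ.length e * (h (Γ.src e) + h (Γ.tgt e)) / 2 := by
  have h1 : ∫ t in (0 : ℝ)..Γ.length e, onEdge (interpolate h : Γ.Point → ℝ) e t =
      ∫ t in (0 : ℝ)..Γ.length e,
        ((h (Γ.tgt e) - h (Γ.src e)) / Γ.length e * t + h (Γ.src e)) := by
    refine intervalIntegral.integral_congr fun t ht => ?_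
    rw [uIcc_of_le (Γ.length_pos e).le] at ht
    exact onEdge_interpolate h e ht
  have := (Γ.length_pos e).ne'
  rw [h1, intervalIntegral.integral_add (Continuous.intervalIntegrable (by fun_prop) _ _)
    (Continuous.intervalIntegrable (by fun_prop) _ _), intervalIntegral.integral_const_mul,
    integral_id, intervalIntegral.integral_const, smul_eq_mul]
  field_simp
  ring

theorem integral_onEdge_edgeGreen_self (e : E) (s : Icc (0 : ℝ) (Γ.length e)) :
    ∫ t in (0 : ℝ)..Γ.length e, onEdge (fun x => edgeGreen x (Γ.edgePoint e s)) e t =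
      s * (Γ.length e - s) / 2 := by
  have hcont : Continuous (onEdge (fun x => edgeGreen x (Γ.edgePoint e s)) e) :=
    (continuous_edgeGreen _).comp ((continuous_edgePoint e).comp continuous_projIcc)
  have h1 : ∫ t in (0 : ℝ)..s, onEdge (fun x => edgeGreen x (Γ.edgePoint e s)) e t =
      ∫ t in (0 : ℝ)..s, ((1 - s / Γ.length e) * t + 0) := by
    refine intervalIntegral.integral_congr fun t ht => ?_
    rw [uIcc_of_le s.2.1] at ht
    exact onEdge_edgeGreen_of_le e s ht.1 ht.2
  have h2 : ∫ t in (s : ℝ)..Γ.length e, onEdge (fun x => edgeGreen x (Γ.edgePoint e s)) e t =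
      ∫ t in (s : ℝ)..Γ.length e, (-(s / Γ.length e) * t + s) := by
    refine intervalIntegral.integral_congr fun t ht => ?_
    rw [uIcc_of_le s.2.2] at ht
    exact onEdge_edgeGreen_of_ge e s ht.1 ht.2
  have := (Γ.length_pos e).ne'
  rw [← intervalIntegral.integral_add_adjacent_intervals (hcont.intervalIntegrable 0 s)
    (hcont.intervalIntegrable s _), h1, h2,
    intervalIntegral.integral_add (Continuous.intervalIntegrable (by fun_prop) _ _)
    (Continuous.intervalIntegrable (by fun_prop) _ _),
    intervalIntegral.integral_add (Continuous.intervalIntegrable (by fun_prop) _ _)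
    (Continuous.intervalIntegrable (by fun_prop) _ _), intervalIntegral.integral_const_mul,
    intervalIntegral.integral_const_mul,
    integral_id, integral_id, intervalIntegral.integral_const, intervalIntegral.integral_const,
    smul_eq_mul, smul_eq_mul]
  field_simp
  ring

theorem integral_onEdge_edgeGreen_of_ne {e e' : E} (h : e ≠ e') (s : Icc (0 : ℝ) (Γ.length e')) :
    ∫ t in (0 : ℝ)..Γ.length e, onEdge (fun x => edgeGreen x (Γ.edgePoint e' s)) e t = 0 := by
  simp [onEdge_edgeGreen_of_ne h]

variable [Fintype V] [Fintype E]

/-- The signed measure with point mass `a v` at the vertex `v` and constant density `m e` on the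
edge `e`. -/
def vertexEdgeMeasure (a : V → ℝ) (m : E → ℝ) : SignedMeasure Γ.Point :=
  ∑ v, a v • (Measure.dirac (Γ.vertex v)).toSignedMeasure +
    ∑ e, m e • (Γ.edgeMeasure e).toSignedMeasure

theorem integral_vertexEdgeMeasure (a : V → ℝ) (m : E → ℝ) {f : Γ.Point → ℝ}
    (hf : Continuous f) :
    ∫ᵛ x, f x ∂<•(vertexEdgeMeasure a m) =
      ∑ v, a v * f (Γ.vertex v) + ∑ e, m e * ∫ t in (0 : ℝ)..Γ.length e, onEdge f e t := by
  rw [vertexEdgeMeasure, VectorMeasure.integral_add_vectorMeasure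
    (integrable_of_continuous _ hf) (integrable_of_continuous _ hf),
    VectorMeasure.integral_finsetSum_vectorMeasure fun _ _ => integrable_of_continuous _ hf,
    VectorMeasure.integral_finsetSum_vectorMeasure fun _ _ => integrable_of_continuous _ hf]
  congr 1
  · refine Finset.sum_congr rfl fun v _ => ?_
    rw [VectorMeasure.integral_smul_vectorMeasure, VectorMeasure.integral_toSignedMeasure,
      integral_dirac' _ _ hf.measurable.stronglyMeasurable, smul_eq_mul]
  · refine Finset.sum_congr rfl fun e _ => ?_
    rw [VectorMeasure.integral_smul_vectorMeasure, VectorMeasure.integral_toSignedMeasure,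
      integral_edgeMeasure e hf, smul_eq_mul]

/-! ### Existence of the canonical measure -/

/-- The density of the canonical measure on the edge `e`. -/
def edgeDensity (G : V → V → ℝ) (e : E) : ℝ :=
  (Γ.length e - (G (Γ.src e) (Γ.src e) + G (Γ.tgt e) (Γ.tgt e) - 2 * G (Γ.src e) (Γ.tgt e))) /
    Γ.length e ^ 2

/-- On the diagonal the bilinear interpolation falls short of the linear one by r s(L - s)/L², with
r the resistance between the ends, while the edge term adds s(L - s)/L. This produces the density (L
- r)/L². -/
theorem IsGreenMatrix.potentialKernel_self {G : V → V → ℝ} (hG : IsGreenMatrix (Γ := Γ) G)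
    (e : E) (s : Icc (0 : ℝ) (Γ.length e)) :
    potentialKernel G (Γ.edgePoint e s) (Γ.edgePoint e s) =
      interpolate (fun v => G v v) (Γ.edgePoint e s) +
        edgeDensity (Γ := Γ) G e * (s * (Γ.length e - s)) := by
  have := (Γ.length_pos e).ne'
  rw [potentialKernel, edgeGreen_edgePoint_self, edgeDensity]
  simp only [interpolate_edgePoint, min_self, hG.symm (Γ.tgt e) (Γ.src e)]
  field_simp
  ring

/-- The Dirichlet Green function of an edge has integral s(L - s)/2 over that edge, so the chosen
density reproduces the quadratic term. The vertex weights `a` are arbitrary because `edgeGreen`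
vanishes at vertices. -/
theorem IsGreenMatrix.potentialKernel_self_eq_integral {G : V → V → ℝ}
    (hG : IsGreenMatrix (Γ := Γ) G) (a : V → ℝ) (x : Γ.Point) :
    potentialKernel G x x = interpolate (fun v => G v v) x +
      2 * ∫ᵛ z, edgeGreen z x ∂<•(vertexEdgeMeasure a (edgeDensity (Γ := Γ) G)) := by
  rw [integral_vertexEdgeMeasure _ _ (continuous_edgeGreen x)]
  induction x using point_cases with
  | hv v => simp [potentialKernel, onEdge]
  | he e s h0 h1 =>
    rw [hG.potentialKernel_self, Finset.sum_eq_single e]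
    · simp only [edgeGreen_vertex_left, mul_zero, Finset.sum_const_zero, zero_add,
        integral_onEdge_edgeGreen_self]
      ring
    · intro e' _ h
      rw [integral_onEdge_edgeGreen_of_ne h, mul_zero]
    · simp

theorem continuous_potentialKernel_self {G : V → V → ℝ} (hG : IsGreenMatrix (Γ := Γ) G) :
    Continuous fun x : Γ.Point => potentialKernel G x x := by
  refine continuous_of_continuous_edgePoint fun e => ?_
  simp only [hG.potentialKernel_self, interpolate_edgePoint]
  fun_prop

/-- Integration of interpolated functions against `vertexEdgeMeasure`. -/
theorem integral_interpolate_vertexEdgeMeasure (b : V → ℝ) (m : E → ℝ) :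
    ∃ a : V → ℝ, ∀ h : V → ℝ,
      ∫ᵛ x, interpolate h x ∂<•(vertexEdgeMeasure (Γ := Γ) a m) = ∑ v, b v * h v := by
  classical
  -- An affine function on an edge averages to the mean of its end values, so half of the mass of
  -- each edge is taken off at each end.
  refine ⟨fun v => b v - ∑ e, m e * (Γ.length e * ((if Γ.src e = v then 1 else 0) +
    (if Γ.tgt e = v then 1 else 0)) / 2), fun h => ?_⟩
  rw [integral_vertexEdgeMeasure _ _ (continuous_interpolate h)]
  simp only [integral_onEdge_interpolate, interpolate_vertex, sub_mul, Finset.sum_sub_distrib,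
    Finset.sum_mul]
  rw [Finset.sum_comm, sub_add_eq_add_sub, add_sub_assoc, ← Finset.sum_sub_distrib]
  refine add_eq_left.2 (Finset.sum_eq_zero fun e _ => ?_)
  have h1 : ∑ v, m e * (Γ.length e * ((if Γ.src e = v then 1 else 0) +
      (if Γ.tgt e = v then 1 else 0)) / 2) * h v =
      m e * Γ.length e / 2 * ∑ v, ((if Γ.src e = v then h v else 0) +
        (if Γ.tgt e = v then h v else 0)) := by
    rw [Finset.mul_sum]
    refine Finset.sum_congr rfl fun v _ => ?_
    split_ifs <;> ring
  rw [h1, Finset.sum_add_distrib]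
  simp only [Finset.sum_ite_eq, Finset.mem_univ, if_true]
  ring

-- Constancy of j_μ(x, x) means that k(x, x) - 2 ∫ k(z, x) dμ(z) is constant in x. The edge
-- densities take care of the quadratic part; the vertex weights must take care of the interpolated
-- part.
variable (Γ) in
theorem exists_isCanonicalMeasure : ∃ μ : SignedMeasure Γ.Point, IsCanonicalMeasure μ := by
  have : Nonempty V := Γ.nonempty
  have hn : (Fintype.card V : ℝ) ≠ 0 := Nat.cast_ne_zero.2 Fintype.card_ne_zero
  obtain ⟨G, hG⟩ := Γ.exists_isGreenMatrix
  let d : V → ℝ := fun v => G v v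
  -- Chosen so that twice the Green matrix applied to `b` is `d` up to a constant; the second
  -- summand makes the total mass 1.
  let b : V → ℝ := fun v => 1 / 2 * Γ.vertexLaplacian d v + 1 / Fintype.card V
  obtain ⟨a, ha⟩ := integral_interpolate_vertexEdgeMeasure (Γ := Γ) b (edgeDensity (Γ := Γ) G)
  set μ : SignedMeasure Γ.Point := vertexEdgeMeasure a (edgeDensity (Γ := Γ) G) with hμ
  have hb : ∑ v, b v = 1 := by
    simp only [b, Finset.sum_add_distrib, ← Finset.mul_sum, sum_vertexLaplacian]
    simp [hn]
  have hμ1 : μ univ = 1 := by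
    have h1 := ha fun _ => 1
    simp only [interpolate_const, mul_one, hb] at h1
    rw [integral_const_signed, mul_one] at h1
    exact h1
  -- Self-adjointness moves the Laplacian from `d` onto the column of `G`, where it is an indicator
  -- minus 1/card V.
  have hGb : ∀ u, ∑ v, b v * G v u =
      1 / 2 * (d u - 1 / Fintype.card V * ∑ v, d v) + 1 / Fintype.card V * (1 / Fintype.card V) := by
    intro u
    have h1 : ∑ v, b v * G v u = 1 / 2 * ∑ v, Γ.vertexLaplacian d v * G v u +
        1 / Fintype.card V * ∑ v, G u v := by
      simp only [b, Finset.mul_sum, ← Finset.sum_add_distrib]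
      refine Finset.sum_congr rfl fun v _ => ?_
      rw [hG.symm u v]; ring
    classical
    have h2 : ∀ v, Γ.vertexLaplacian (fun w => G w u) v =
        (if v = u then 1 else 0) - 1 / Fintype.card V := fun v => by
      by_cases h : v = u
      · subst h; simp [hG.vertexLaplacian_self]
      · simp [hG.vertexLaplacian_of_ne v u h, h]
    rw [h1, hG.sum_eq, ← sum_mul_vertexLaplacian_comm]
    simp only [h2, mul_sub, Finset.sum_sub_distrib, mul_ite, mul_one, mul_zero, Finset.sum_ite_eq',
      Finset.mem_univ, if_true, ← Finset.sum_mul]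
    ring
  refine ⟨μ, hμ1, 1 / Fintype.card V * ∑ v, d v -
    2 * (1 / Fintype.card V * (1 / Fintype.card V)) + ∫ᵛ z, potentialKernel G z z ∂<•μ,
    fun x => ?_⟩
  have hK : ∫ᵛ z, potentialKernel G z x ∂<•μ =
      interpolate (fun u => ∑ v, b v * G v u) x + ∫ᵛ z, edgeGreen z x ∂<•μ := by
    simp only [potentialKernel]
    rw [VectorMeasure.integral_fun_add (integrable_of_continuous _ (continuous_interpolate _))
      (integrable_of_continuous _ (continuous_edgeGreen x)), ha, interpolate_sum]
    simp only [interpolate_const_mul]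
  have h1 : voltageMeasure μ x x = potentialKernel G x x - 2 * ∫ᵛ z, potentialKernel G z x ∂<•μ +
      ∫ᵛ z, potentialKernel G z z ∂<•μ := by
    have h2 : ∀ z, voltage z x x = potentialKernel G x x - 2 * potentialKernel G z x +
        potentialKernel G z z := fun z => by
      rw [hG.voltage_eq, hG.potentialKernel_comm x z]; ring
    have i1 := integrable_of_continuous μ (continuous_potentialKernel G x)
    have i2 := integrable_of_continuous μ (continuous_potentialKernel_self hG)
    have i3 := integrable_of_continuous μ (continuous_const (y := potentialKernel G x x))
    have i4 : μ.Integrable fun z => 2 * potentialKernel G z x := i1.const_mul 2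
    simp only [voltageMeasure, h2]
    rw [VectorMeasure.integral_fun_add (i3.fun_sub i4) i2, VectorMeasure.integral_fun_sub i3 i4,
      integral_const_signed, hμ1, integral_const_mul_signed, one_mul]
  -- The integrals of `edgeGreen` cancel, and so do the interpolations of `d`; only constants
  -- remain.
  rw [h1, hK, hG.potentialKernel_self_eq_integral a x, ← hμ]
  simp only [hGb, interpolate_add, interpolate_sub, interpolate_const_mul, interpolate_const]
  ring

/-! ### The Arakelov-Green function of the canonical measure -/

variable (Γ) in
theorem isCanonicalMeasure_canonicalMeasure : IsCanonicalMeasure Γ.canonicalMeasure :=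
  Classical.epsilon_spec Γ.exists_isCanonicalMeasure

theorem two_mul_tau (x : Γ.Point) : voltageMeasure Γ.canonicalMeasure x x = 2 * Γ.tau := by
  obtain ⟨-, c, hc⟩ := isCanonicalMeasure_canonicalMeasure Γ
  have h := Classical.epsilon_spec
    (p := fun t : ℝ => ∀ x, t = voltageMeasure Γ.canonicalMeasure x x / 2)
    ⟨c / 2, fun x => by rw [hc]⟩ x
  have h' : Γ.tau = voltageMeasure Γ.canonicalMeasure x x / 2 := h
  linarith

theorem resistance_comm (x y : Γ.Point) : resistance x y = resistance y x := by
  obtain ⟨G, hG⟩ := Γ.exists_isGreenMatrix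
  rw [resistance, resistance, hG.voltage_eq, hG.voltage_eq]
  ring

theorem voltage_eq_resistance (z x y : Γ.Point) :
    voltage z x y = 1 / 2 * (resistance x z + resistance y z - resistance x y) := by
  obtain ⟨G, hG⟩ := Γ.exists_isGreenMatrix
  simp only [resistance, hG.voltage_eq, hG.potentialKernel_comm z x, hG.potentialKernel_comm z y,
    hG.potentialKernel_comm y x]
  ring

theorem continuous_resistance (y : Γ.Point) : Continuous fun x => resistance x y := by
  obtain ⟨G, hG⟩ := Γ.exists_isGreenMatrix
  simp only [resistance, hG.voltage_eq, hG.potentialKernel_comm y]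
  exact ((continuous_potentialKernel_self hG).sub (continuous_potentialKernel G y)).sub
    ((continuous_potentialKernel G y).sub continuous_const)

/-- By definition j_z(y, y) = r(y, z), so the integral is j_μ(y, y) after using the symmetry of r.
-/
theorem integral_resistance (y : Γ.Point) :
    ∫ᵛ x, resistance x y ∂<•Γ.canonicalMeasure = 2 * Γ.tau := by
  rw [← two_mul_tau y, voltageMeasure]
  simp only [resistance_comm _ y]
  rfl

theorem voltageMeasure_canonicalMeasure (x y : Γ.Point) :
    ∫ᵛ z, voltage z x y ∂<•Γ.canonicalMeasure = 2 * Γ.tau - 1 / 2 * resistance x y := by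
  have hμ := (isCanonicalMeasure_canonicalMeasure Γ).1
  have i : ∀ y : Γ.Point, Γ.canonicalMeasure.Integrable fun z => resistance y z := fun y => by
    simp only [resistance_comm y]
    exact integrable_of_continuous _ (continuous_resistance y)
  have ic := integrable_of_continuous Γ.canonicalMeasure (continuous_const (y := resistance x y))
  have hI : ∀ y : Γ.Point, ∫ᵛ z, resistance y z ∂<•Γ.canonicalMeasure = 2 * Γ.tau := two_mul_tau
  simp only [voltage_eq_resistance _ x y]
  rw [integral_const_mul_signed, VectorMeasure.integral_fun_sub ((i x).fun_add (i y)) ic,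
    VectorMeasure.integral_fun_add (i x) (i y), hI, hI, integral_const_signed, hμ]
  ring

theorem arakelovGreen_canonicalMeasure (x y : Γ.Point) :
    arakelovGreen Γ.canonicalMeasure x y = Γ.tau - 1 / 2 * resistance x y := by
  have hμ := (isCanonicalMeasure_canonicalMeasure Γ).1
  have h1 : ∀ y : Γ.Point, ∫ᵛ x, (2 * Γ.tau - 1 / 2 * resistance x y) ∂<•Γ.canonicalMeasure =
      Γ.tau := fun y => by
    rw [VectorMeasure.integral_fun_sub (integrable_of_continuous _ continuous_const)
      ((integrable_of_continuous _ (continuous_resistance y)).const_mul _),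
      integral_const_mul_signed _ (1 / 2), integral_resistance, integral_const_signed, hμ]
    ring
  rw [arakelovGreen]
  simp only [voltageMeasure_canonicalMeasure, h1]
  rw [integral_const_signed, hμ]
  ring

end MetrizedGraph

end

/-! ### The explicit formulas on the edges -/

open MetrizedGraph in
theorem theorem4p3 {V E : Type*} [Fintype V] [Fintype E] (Γ : MetrizedGraph V E) :
    (∀ i j : E, i ≠ j → ¬ Γ.IsBridge i → ¬ Γ.IsBridge j →
      ∀ (x : Set.Icc (0 : ℝ) (Γ.length i)) (y : Set.Icc (0 : ℝ) (Γ.length j)),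
        arakelovGreen Γ.canonicalMeasure (Γ.edgePoint i x) (Γ.edgePoint j y) =
          Γ.tau
            + (x : ℝ) ^ 2 *
              ((Γ.length i - resistance (Γ.startPoint i) (Γ.endPoint i)) / (2 * Γ.length i ^ 2))
            + (y : ℝ) ^ 2 *
              ((Γ.length j - resistance (Γ.startPoint j) (Γ.endPoint j)) / (2 * Γ.length j ^ 2))
            - (x : ℝ) * (y : ℝ) / (Γ.length i * Γ.length j) *
              (voltage (Γ.startPoint j) (Γ.startPoint i) (Γ.endPoint j)
                - voltage (Γ.startPoint j) (Γ.endPoint i) (Γ.endPoint j))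
            - (x : ℝ) / (2 * Γ.length i) *
              (Γ.length i - 2 * voltage (Γ.startPoint i) (Γ.endPoint i) (Γ.startPoint j))
            - (y : ℝ) / (2 * Γ.length j) *
              (Γ.length j - 2 * voltage (Γ.startPoint j) (Γ.startPoint i) (Γ.endPoint j))
            - 1 / 2 * resistance (Γ.startPoint i) (Γ.startPoint j)) ∧
    (∀ (i : E) (x y : Set.Icc (0 : ℝ) (Γ.length i)),
        arakelovGreen Γ.canonicalMeasure (Γ.edgePoint i x) (Γ.edgePoint i y) =
          Γ.tau - 1 / 2 * |(x : ℝ) - (y : ℝ)|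
            + ((x : ℝ) - (y : ℝ)) ^ 2 *
              ((Γ.length i - resistance (Γ.startPoint i) (Γ.endPoint i)) /
                (2 * Γ.length i ^ 2))) := by
  -- The kernel depends on the Green matrix, but r and j do not. At vertices the kernel equals `G`,
  -- so both sides become rational expressions in `G`, the lengths and the parameters.
  obtain ⟨G, hG⟩ := Γ.exists_isGreenMatrix
  have hr : ∀ x y : Γ.Point, resistance x y = potentialKernel G x x + potentialKernel G y y -
      2 * potentialKernel G x y := fun x y => by
    rw [resistance, hG.voltage_eq, hG.potentialKernel_comm y x]; ring
  have hv : ∀ u v : V, potentialKernel G (Γ.vertex u) (Γ.vertex v) = G u v := fun u v => by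
    simp [potentialKernel]
  refine ⟨fun i j hij _ _ x y => ?_, fun i x y => ?_⟩
  · have hi := (Γ.length_pos i).ne'
    have hj := (Γ.length_pos j).ne'
    -- On distinct edges the mixed term is purely bilinear in the parameters; the squares come only
    -- from the diagonal values.
    have hxy : potentialKernel G (Γ.edgePoint i x) (Γ.edgePoint j y) =
        interpolate (fun u => interpolate (fun v => G u v) (Γ.edgePoint j y))
          (Γ.edgePoint i x) := by
      rw [potentialKernel, edgeGreen_edgePoint_of_ne hij, add_zero]
    simp only [arakelovGreen_canonicalMeasure, hr, hG.voltage_eq, startPoint, endPoint, hv, hxy,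
      hG.potentialKernel_self, edgeDensity, interpolate_edgePoint,
      hG.symm (Γ.tgt i) (Γ.src i)]
    field_simp
    ring
  · have hi := (Γ.length_pos i).ne'
    -- On a common edge the absolute value arises from the minimum in the edge Green function.
    have hmin : |(x : ℝ) - y| = x + y - 2 * min (x : ℝ) y := by
      rcases le_total (x : ℝ) y with h | h
      · rw [min_eq_left h, abs_of_nonpos (by linarith)]; ring
      · rw [min_eq_right h, abs_of_nonneg (by linarith)]; ring
    have hxy : potentialKernel G (Γ.edgePoint i x) (Γ.edgePoint i y) =
        interpolate (fun u => interpolate (fun v => G u v) (Γ.edgePoint i y))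
          (Γ.edgePoint i x) + (min (x : ℝ) y - x * y / Γ.length i) := by
      rw [potentialKernel, edgeGreen_edgePoint_self]
    simp only [arakelovGreen_canonicalMeasure, hr, startPoint, endPoint, hv, hxy, hmin,
      hG.potentialKernel_self, edgeDensity, interpolate_edgePoint,
      hG.symm (Γ.tgt i) (Γ.src i)]
    field_simp
    ring
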